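/- **Theorem 1.6.** Let $P$ be an interval order, that is, a partially ordered set isomorphic to a set of nonempty intervals (order-convex subsets) of some chain $C$, where $I<J$ means that $x<y$ for all $x\in I$, $y\in J$. Then $P$ is better-quasi-ordered (bqo) if and only if $P$ is well-quasi-ordered (wqo). Here $P$ is *wqo* if it is well-founded and has no infinite antichain, equivalently, if for every sequence $(x_n)_{n\in\mathbb N}$ in $P$ there are $m<n$ with $x_m\le x_n$. Finite subsets of $\mathbb N$ are identified with strictly increasing finite sequences. A *barrier* is an infinite set $B$ of finite subsets of $\mathbb N$ that is an antichain for inclusion and such that every infinite $X\subseteq\bigcup B$ has a nonempty initial segment belonging to $B$. For finite $s,t\subseteq\mathbb N$ write $s\triangleleft t$ if there is a finite $r\subseteq\mathbb N$ such that $s$ is a proper initial segment of $r$ and $t$ is obtained from $r$ by deleting its least element. The order type of a barrier is taken with respect to the lexicographic order, which well-orders it. For a countable ordinal $\alpha$, $P$ is *$\alpha$-bqo* if for every barrier $B$ of order type at most $\alpha$ and every map $f:B\to P$ there are $s,t\in B$ with $s\triangleleft t$ and $f(s)\le f(t)$. $P$ is *bqo* if it is $\alpha$-bqo for every countable ordinal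 $\alpha$. -/

import Mathlib

universe u v

namespace Bqo

/-! ### Finite sets of natural numbers, seen as strictly increasing sequences -/

/-- `s ≤_in X`: the finite set `s`, listed increasingly, is an initial segment of the set `X`. -/
def IsInit (s : Finset ℕ) (X : Set ℕ) : Prop :=
  (s : Set ℕ) ⊆ X ∧ ∀ x ∈ X, ∀ y ∈ s, x ≤ y → x ∈ s

/-- The sequence `s` without its first (least) element; the empty sequence stays empty. -/
def tail (s : Finset ℕ) : Finset ℕ :=
  s.filter fun x => ∃ y ∈ s, y < x

/-- `s ◁ t`: there is a finite `r` of which `s` is a proper initial segment and such that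
`t` is `r` without its first element. -/
def Tri (s t : Finset ℕ) : Prop :=
  ∃ r : Finset ℕ, IsInit s r ∧ s ≠ r ∧ t = tail r

/-- The strict lexicographic order on finite sets of natural numbers, each listed increasingly. -/
def LexLT (s t : Finset ℕ) : Prop :=
  List.Lex (· < ·) (s.sort (· ≤ ·)) (t.sort (· ≤ ·))

/-! ### Barriers and better-quasi-orders -/

/-- The union `⋃ B` of a set `B` of finite sets of natural numbers. -/
def base (B : Set (Finset ℕ)) : Set ℕ := {n | ∃ s ∈ B, n ∈ s}

/-- A block: an infinite set of finite sets of natural numbers such that every infinite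
`X ⊆ ⋃ B` has a nonempty initial segment in `B`. -/
def IsBlock (B : Set (Finset ℕ)) : Prop :=
  B.Infinite ∧ ∀ X : Set ℕ, X.Infinite → X ⊆ base B → ∃ s ∈ B, s ≠ ∅ ∧ IsInit s X

/-- A barrier: a block that is an antichain for inclusion. -/
def IsBarrier (B : Set (Finset ℕ)) : Prop :=
  IsBlock B ∧ IsAntichain (· ⊆ ·) B

/-- `B` is well ordered by the lexicographic order, with order type at most `α`. -/
def LexTypeLE (B : Set (Finset ℕ)) (α : Ordinal.{0}) : Prop :=
  ∃ _ : IsWellOrder B (fun s t => LexLT s t), Ordinal.type (fun s t : B => LexLT s t) ≤ α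

/-- A map from `B` into `P` is good if `f s ≤ f t` for some `s ◁ t` in `B`. -/
def IsGood {P : Type*} [LE P] {B : Set (Finset ℕ)} (f : B → P) : Prop :=
  ∃ s t : B, Tri s t ∧ f s ≤ f t

/-- `P` is `α`-better-quasi-ordered: every map into `P` from a barrier of order type at most `α`
is good. -/
def IsAlphaBqo (α : Ordinal.{0}) (P : Type*) [LE P] : Prop :=
  ∀ B : Set (Finset ℕ), IsBarrier B → LexTypeLE B α → ∀ f : B → P, IsGood f

/-- `P` is better-quasi-ordered: it is `α`-better-quasi-ordered for every countable ordinal `α`. -/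
def IsBqo (P : Type*) [LE P] : Prop :=
  ∀ α : Ordinal.{0}, α.card ≤ Cardinal.aleph0 → IsAlphaBqo α P

/-! ### Interval orders -/

/-- The nonempty intervals (order-convex subsets) of a chain `C`. -/
def Intervals (C : Type*) [LinearOrder C] : Type _ :=
  {I : Set C // I.Nonempty ∧ I.OrdConnected}

/-- Intervals are ordered by `I < J` iff every element of `I` is less than every element of `J`. -/
instance (C : Type*) [LinearOrder C] : PartialOrder (Intervals C) where
  le I J := I = J ∨ ∀ x ∈ I.1, ∀ y ∈ J.1, x < y
  lt I J := ∀ x ∈ I.1, ∀ y ∈ J.1, x < y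
  le_refl I := Or.inl rfl
  le_trans I J K := by
    rintro (rfl | h) (rfl | h')
    · exact Or.inl rfl
    · exact Or.inr h'
    · exact Or.inr h
    · obtain ⟨j, hj⟩ := J.2.1
      exact Or.inr fun x hx z hz => (h x hx j hj).trans (h' j hj z hz)
  lt_iff_le_not_ge I J := by
    obtain ⟨i, hi⟩ := I.2.1
    obtain ⟨j, hj⟩ := J.2.1
    constructor
    · intro h
      refine ⟨Or.inr h, ?_⟩
      rintro (rfl | h')
      · exact lt_irrefl _ (h i hi i hi)
      · exact lt_asymm (h i hi j hj) (h' j hj i hi)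
    · rintro ⟨rfl | h, h'⟩
      · exact absurd (Or.inl rfl) h'
      · exact h
  le_antisymm I J := by
    rintro (rfl | h) (h' | h')
    · rfl
    · rfl
    · exact h'.symm
    · obtain ⟨i, hi⟩ := I.2.1
      obtain ⟨j, hj⟩ := J.2.1
      exact absurd (h' j hj i hi) (lt_asymm (h i hi j hj))

/-- `P` is an interval order: it is isomorphic, as a poset, to a set of nonempty intervals of some
chain. -/
def IsIntervalOrder (P : Type u) [PartialOrder P] : Prop :=
  ∃ (C : Type v) (_ : LinearOrder C) (S : Set (Intervals C)), Nonempty (P ≃o S)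

end Bqo

namespace Bqo

open Stream' Filter

/-! ### Locally constant functions of an infinite sequence -/

/-! A map on a barrier becomes a locally constant `F` on sequences: apply it to the initial segment
of `x` lying in the barrier. For an ultrafilter `U`, the claim is that `F x ≤ F x.tail` for generic
`x` (`LocConst.ev_le_tail`). Interval orders enter only through the absence of `2 + 2`.

Let `k x` be the least length of a prefix of `x` deciding `F`, and `I x` the ideal of elements
generically below `F` once all but the last deciding term is fixed. By wqo, `k` and `I` take values
in well-founded orders, so neither generically decreases under the shift, and `F x ∈ I x`. After a
harmless change of `F` these ideals have no maximal element, hence are comparable because `2 + 2` is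
absent, so `I x ≤ I x.tail`. Thus `F x` is below a generic value of `F` near `x.tail`, and since `k
x ≤ k x.tail` that value is reached by altering `x` without altering `F x`.

Conversely, singletons form a barrier, and maps on it are sequences. -/

/-- `F` is locally constant: the value `F x` only depends on a finite prefix of `x`. -/
def LocConst {α : Type*} (F : Stream' ℕ → α) : Prop :=
  ∀ x, ∃ n, ∀ z, F (x.take n ++ₛ z) = F x

namespace LocConst

variable {α β γ : Type*} {F : Stream' ℕ → α} {G : Stream' ℕ → β}

theorem const (c : α) : LocConst fun _ => c := fun _ => ⟨0, fun _ => rfl⟩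

theorem take_append_of_le {x z : Stream' ℕ} {n m : ℕ} (h : n ≤ m) :
    ∃ w, x.take m ++ₛ z = x.take n ++ₛ w := by
  obtain ⟨k, rfl⟩ := Nat.exists_eq_add_of_le h
  refine ⟨(x.drop n).take k ++ₛ z, ?_⟩
  rw [← append_append_stream, ← take_add]

theorem comp₂ (hF : LocConst F) (hG : LocConst G) (f : α → β → γ) :
    LocConst fun x => f (F x) (G x) := by
  intro x
  obtain ⟨n, hn⟩ := hF x
  obtain ⟨m, hm⟩ := hG x
  refine ⟨max n m, fun z => ?_⟩
  obtain ⟨w, hw⟩ := take_append_of_le (x := x) (z := z) (le_max_left n m)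
  obtain ⟨w', hw'⟩ := take_append_of_le (x := x) (z := z) (le_max_right n m)
  have h1 := hn w
  have h2 := hm w'
  rw [← hw] at h1
  rw [← hw'] at h2
  simp only [h1, h2]

theorem comp (hF : LocConst F) (f : α → γ) : LocConst fun x => f (F x) :=
  hF.comp₂ hF fun a _ => f a

theorem tail (hF : LocConst F) : LocConst fun x => F x.tail := by
  intro x
  obtain ⟨n, hn⟩ := hF x.tail
  refine ⟨n + 1, fun z => ?_⟩
  simp only [take_succ, cons_append_stream, tail_cons, hn]

theorem cons (hF : LocConst F) (p : ℕ) : LocConst fun x => F (p :: x) := by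
  intro x
  obtain ⟨n, hn⟩ := hF (p :: x)
  refine ⟨n, fun z => ?_⟩
  obtain ⟨w, hw⟩ := take_append_of_le (x := p :: x) (z := z) n.le_succ
  have := hn w
  rwa [← hw, take_succ, head_cons, tail_cons, cons_append_stream] at this

theorem append (hF : LocConst F) (s : List ℕ) : LocConst fun x => F (s ++ₛ x) := by
  induction s generalizing F with
  | nil => exact hF
  | cons p s ih => exact ih (hF.cons p)

theorem glue {H : ℕ → Stream' ℕ → α} (h : ∀ p, LocConst (H p)) :
    LocConst fun x => H x.head x.tail := by
  intro x
  obtain ⟨n, hn⟩ := h x.head x.tail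
  refine ⟨n + 1, fun z => ?_⟩
  simp only [take_succ, cons_append_stream, tail_cons, head_cons, hn]

theorem get (i : ℕ) : LocConst fun x : Stream' ℕ => x.get i := by
  induction i with
  | zero => exact glue (H := fun p _ => p) fun p => const p
  | succ i ih => exact ih.tail

/-- Bar induction for locally constant functions. -/
theorem bar_induction {C : (Stream' ℕ → α) → Prop} (hF : LocConst F) (h0 : ∀ c, C fun _ => c)
    (h1 : ∀ F, LocConst F → (∀ p, C fun x => F (p :: x)) → C F) : C F := by
  by_contra hC
  have step : ∀ F : {F : Stream' ℕ → α // LocConst F ∧ ¬ C F},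
      ∃ p, ¬ C fun x => F.1 (p :: x) := by
    rintro ⟨F, hF, hC⟩
    by_contra! h
    exact hC (h1 F hF h)
  choose p hp using step
  -- Following a failing section at every stage traces a branch `x`; along it `F` is eventually
  -- decided, so some failing section is constant.
  let st : ℕ → {F : Stream' ℕ → α // LocConst F ∧ ¬ C F} := fun n =>
    Nat.rec ⟨F, hF, hC⟩ (fun _ G => ⟨fun x => G.1 (p G :: x), G.2.1.cons _, hp G⟩) n
  let x : Stream' ℕ := fun n => p (st n)
  have hst : ∀ n, (st n).1 = fun z => F (x.take n ++ₛ z) := by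
    intro n
    induction n with
    | zero => rfl
    | succ n ih =>
      have : (st (n + 1)).1 = fun z => (st n).1 (p (st n) :: z) := rfl
      rw [this, ih]
      funext z
      rw [take_succ', append_append_stream]
      rfl
  obtain ⟨n, hn⟩ := hF x
  apply (st n).2.2
  rw [hst n]
  simp only [hn]
  exact h0 _

end LocConst

/-! ### The iterated ultrafilter quantifier -/

variable {U : Ultrafilter ℕ} {D E : Stream' ℕ → Prop}

/-- `Ev U D`: after finitely many successive choices of `U`-almost all terms, `D` is certain. -/
inductive Ev (U : Ultrafilter ℕ) : (Stream' ℕ → Prop) → Prop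
  | of_forall (D : Stream' ℕ → Prop) (h : ∀ x, D x) : Ev U D
  | step (D : Stream' ℕ → Prop) (A : Set ℕ) (hA : A ∈ U)
      (h : ∀ p ∈ A, Ev U fun x => D (p :: x)) : Ev U D

namespace Ev

theorem eventually (h : Ev U D) : ∀ᶠ p in U, Ev U fun x => D (p :: x) := by
  cases h with
  | of_forall _ h => exact Eventually.of_forall fun p => of_forall _ fun x => h _
  | step _ A hA h => exact mem_of_superset hA h

theorem of_eventually (h : ∀ᶠ p in U, Ev U fun x => D (p :: x)) : Ev U D :=
  step D _ h fun _ hp => hp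

theorem exists_mem (h : Ev U D) : ∃ x, D x := by
  induction h with
  | of_forall D h => exact ⟨Stream'.const 0, h _⟩
  | step D A hA h ih =>
    obtain ⟨p, hp⟩ := U.nonempty_of_mem hA
    obtain ⟨x, hx⟩ := ih p hp
    exact ⟨_, hx⟩

theorem mono (h : Ev U D) (hDE : ∀ x, D x → E x) : Ev U E := by
  induction h generalizing E with
  | of_forall D h => exact of_forall _ fun x => hDE x (h x)
  | step D A hA h ih => exact step _ A hA fun p hp => ih p hp fun x => hDE _

theorem and (hD : Ev U D) (hE : Ev U E) : Ev U fun x => D x ∧ E x := by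
  induction hD generalizing E with
  | of_forall D h => exact hE.mono fun x hx => ⟨h x, hx⟩
  | step D A hA h ih =>
    apply of_eventually
    filter_upwards [hA, hE.eventually] with p hp hEp
    exact ih p hp hEp

theorem tail (hD : Ev U D) : Ev U fun x => D x.tail :=
  of_eventually <| Eventually.of_forall fun _ => hD.mono fun _ hx => hx

theorem or_not (hD : LocConst D) : Ev U D ∨ Ev U fun x => ¬ D x := by
  refine hD.bar_induction (C := fun D => Ev U D ∨ Ev U fun x => ¬ D x) (fun c => ?_) ?_
  · by_cases hc : c
    · exact Or.inl (of_forall _ fun _ => hc)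
    · exact Or.inr (of_forall _ fun _ => hc)
  · intro D _ ih
    rcases Ultrafilter.eventually_or.1 (Eventually.of_forall (f := (U : Filter ℕ)) ih) with h | h
    · exact Or.inl (of_eventually h)
    · exact Or.inr (of_eventually h)

theorem not_iff (hD : LocConst D) : ¬ Ev U D ↔ Ev U fun x => ¬ D x := by
  refine ⟨(or_not hD).resolve_left, fun h h' => ?_⟩
  obtain ⟨x, hx, hx'⟩ := (h.and h').exists_mem
  exact hx hx'

/-- A sequence all of whose tails are generic for a family of events indexed by prefixes. -/
theorem exists_generic {Q : List ℕ → Stream' ℕ → Prop} (hQ : ∀ s, Ev U (Q s)) :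
    ∃ X : Stream' ℕ, ∀ n m, Ev U fun z => Q (X.take n) ((X.drop n).take m ++ₛ z) := by
  have step : ∀ σ : List ℕ × {E : Stream' ℕ → Prop // Ev U E}, ∃ p, Ev U fun x => σ.2.1 (p :: x) :=
    fun σ => σ.2.2.eventually.exists
  choose p hp using step
  -- The state holds the prefix chosen so far and one event conjoining all pending commitments.
  let st : ℕ → List ℕ × {E : Stream' ℕ → Prop // Ev U E} := fun n =>
    Nat.rec ([], ⟨Q [], hQ []⟩)
      (fun _ σ => (σ.1 ++ [p σ], ⟨_, (hp σ).and (hQ (σ.1 ++ [p σ]))⟩)) n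
  let X : Stream' ℕ := fun n => p (st n)
  have h1 : ∀ n, (st n).1 = X.take n := by
    intro n
    induction n with
    | zero => rfl
    | succ n ih =>
      rw [take_succ', ← ih]
      rfl
  have h2 : ∀ n z, (st n).2.1 z → Q (X.take n) z := by
    intro n z hz
    cases n with
    | zero => exact hz
    | succ n =>
      rw [← h1]
      exact hz.2
  have h3 : ∀ n m z, (st (n + m)).2.1 z → (st n).2.1 ((X.drop n).take m ++ₛ z) := by
    intro n m
    induction m with
    | zero => exact fun z hz => hz
    | succ m ih =>
      intro z hz
      rw [take_succ', append_append_stream, get_drop]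
      exact ih _ hz.1
  exact ⟨X, fun n m => (st (n + m)).2.2.mono fun z hz => h2 n _ (h3 n m z hz)⟩

theorem mem_of_generic (hD : LocConst D) {x : Stream' ℕ}
    (h : ∀ m, Ev U fun z => D (x.take m ++ₛ z)) : D x := by
  obtain ⟨m, hm⟩ := hD x
  obtain ⟨z, hz⟩ := (h m).exists_mem
  exact (hm z).mp hz

/-- A locally constant function into a well-founded relation does not decrease under a shift. -/
theorem not_rel_tail {α : Type*} {r : α → α → Prop} (hr : WellFounded r) {G : Stream' ℕ → α}
    (hG : LocConst G) : Ev U fun x => ¬ r (G x.tail) (G x) := by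
  have hD : LocConst fun x => r (G x.tail) (G x) := hG.tail.comp₂ hG r
  rw [← not_iff hD]
  intro h
  obtain ⟨X, hX⟩ := exists_generic fun _ => h
  refine (wellFounded_iff_isEmpty_descending_chain.1 hr).false ⟨fun n => G (X.drop n), fun n => ?_⟩
  simpa using mem_of_generic hD (hX n)

end Ev

namespace LocConst

variable {α : Type*} {F : Stream' ℕ → α}

theorem take_take_append {x z : Stream' ℕ} {m n : ℕ} (h : m ≤ n) :
    (x.take n ++ₛ z).take m = x.take m := by
  rw [Stream'.take_append_of_le_length m (x.take n) z (by simpa using h), take_take, min_eq_right h]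

theorem take {k : Stream' ℕ → ℕ} (hk : LocConst k) : LocConst fun x => x.take (k x) := by
  intro x
  obtain ⟨n, hn⟩ := hk x
  refine ⟨max n (k x), fun z => ?_⟩
  obtain ⟨w, hw⟩ := take_append_of_le (x := x) (z := z) (le_max_left n (k x))
  have h : k (x.take (max n (k x)) ++ₛ z) = k x := by rw [hw, hn]
  simp only [h]
  exact take_take_append (le_max_right _ _)

/-- The least length of a prefix of `x` that determines the value of `F`. -/
theorem exists_modulus (hF : LocConst F) : ∃ k : Stream' ℕ → ℕ, LocConst k ∧
    (∀ x z, F (x.take (k x) ++ₛ z) = F x) ∧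
    ∀ x, ∀ n < k x, ∃ z, F (x.take n ++ₛ z) ≠ F x := by
  classical
  refine ⟨fun x => Nat.find (hF x), fun x => ?_, fun x => Nat.find_spec (hF x), fun x n hn => ?_⟩
  · refine ⟨Nat.find (hF x), fun z => ?_⟩
    rw [Nat.find_eq_iff]
    constructor
    · intro w
      rw [take_take_append le_rfl, Nat.find_spec (hF x), Nat.find_spec (hF x)]
    · intro n hn
      rw [take_take_append hn.le, Nat.find_spec (hF x)]
      exact Nat.find_min (hF x) hn
  · simpa using Nat.find_min (hF x) hn

end LocConst

/-- The ideal of the elements that are eventually below the values of `F`. -/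
def limitIdeal {P : Type*} [PartialOrder P] (U : Ultrafilter ℕ) (F : Stream' ℕ → P) : LowerSet P where
  carrier := {y | Ev U fun x => y ≤ F x}
  lower' _ _ hba ha := Ev.mono ha fun _ hx => hba.trans hx

/-- `F` is eventually equal to a single value. -/
def EvConst {α : Type*} (U : Ultrafilter ℕ) (F : Stream' ℕ → α) : Prop :=
  ∃ c, Ev U fun x => F x = c

/-- Every restriction of `F` to the extensions of a prefix which is eventually constant is
constant. -/
def Clean {α : Type*} (U : Ultrafilter ℕ) (F : Stream' ℕ → α) : Prop :=
  ∀ s : List ℕ, (EvConst U fun z => F (s ++ₛ z)) → ∃ c, ∀ z, F (s ++ₛ z) = c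

/-- By bar induction: glue clean versions of the sections, and if the result is eventually constant,
replace it by that constant. -/
theorem LocConst.exists_clean {α : Type*} {F : Stream' ℕ → α} (hF : LocConst F) :
    ∃ G : Stream' ℕ → α, LocConst G ∧ Clean U G ∧ Ev U fun x => F x = G x := by
  refine hF.bar_induction (C := fun F => ∃ G : Stream' ℕ → α, LocConst G ∧ Clean U G ∧
    Ev U fun x => F x = G x) (fun c => ?_) fun F _ ih => ?_
  · exact ⟨fun _ => c, .const c, fun _ _ => ⟨c, fun _ => rfl⟩, .of_forall _ fun _ => rfl⟩
  · choose G hG hGc hFG using ih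
    have hEv : Ev U fun x => F x = G x.head x.tail :=
      .of_eventually (Eventually.of_forall hFG)
    by_cases h : EvConst U fun x => G x.head x.tail
    · obtain ⟨c, hc⟩ := h
      exact ⟨fun _ => c, .const c, fun _ _ => ⟨c, fun _ => rfl⟩,
        (hEv.and hc).mono fun x hx => hx.1.trans hx.2⟩
    · refine ⟨_, .glue hG, fun s hs => ?_, hEv⟩
      cases s with
      | nil => exact absurd hs h
      | cons p s => exact hGc p s hs

/-! ### Limit ideals in a wqo without `2 + 2` -/

section Limit

variable {P : Type*} [PartialOrder P] {F G : Stream' ℕ → P}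

theorem Ev.finset {ι : Type*} {D : ι → Stream' ℕ → Prop} (s : Finset ι)
    (h : ∀ i ∈ s, Ev U (D i)) : Ev U fun x => ∀ i ∈ s, D i x := by
  classical
  induction s using Finset.induction_on with
  | empty => exact .of_forall _ fun _ i hi => absurd hi (Finset.notMem_empty i)
  | insert a s ha ih =>
    refine ((h a (by simp)).and (ih fun i hi => h i (by simp [hi]))).mono fun x hx => ?_
    simpa using hx

/-- If no value satisfying `Q` were generically below `F`, a generic value would avoid being above
any finitely many earlier ones, giving a bad sequence. -/
theorem LocConst.exists_mem_limitIdeal [WellQuasiOrderedLE P] (hF : LocConst F) {Q : P → Prop}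
    (hQ : Ev U fun x => Q (F x)) : ∃ y, Q y ∧ y ∈ limitIdeal U F := by
  by_contra! h
  obtain ⟨f, -, hf⟩ := exists_seq_of_forall_finset_exists Q (fun a b => ¬ a ≤ b) fun s hs => by
    have := Ev.finset (D := fun a x => ¬ a ≤ F x) s fun a ha =>
      (Ev.not_iff (hF.comp (a ≤ ·))).1 (h a (hs a ha))
    obtain ⟨x, hx⟩ := (hQ.and this).exists_mem
    exact ⟨F x, hx⟩
  obtain ⟨m, n, hmn, hle⟩ := wellQuasiOrdered_le f
  exact hf m n hmn hle

theorem LocConst.ev_mem_limitIdeal [WellQuasiOrderedLE P] (hF : LocConst F) :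
    Ev U fun x => F x ∈ limitIdeal U F := by
  by_contra h
  obtain ⟨y, hy, hy'⟩ := hF.exists_mem_limitIdeal (Q := (· ∉ limitIdeal U F))
    ((Ev.not_iff (hF.comp (· ∈ limitIdeal U F))).1 h)
  exact hy hy'

theorem LocConst.exists_lt_mem_limitIdeal [WellQuasiOrderedLE P] (hF : LocConst F)
    (h : ¬ EvConst U F) {y : P} (hy : y ∈ limitIdeal U F) : ∃ z ∈ limitIdeal U F, y < z := by
  have h1 : Ev U fun x => ¬ F x = y := (Ev.not_iff (hF.comp (· = y))).1 fun h' => h ⟨y, h'⟩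
  obtain ⟨z, hz, hz'⟩ := hF.exists_mem_limitIdeal (Q := (y < ·))
    ((hy.and h1).mono fun x hx => lt_of_le_of_ne hx.1 (Ne.symm hx.2))
  exact ⟨z, hz', hz⟩

/-- In an order without `2 + 2`, limit ideals that are not principal are comparable. -/
theorem limitIdeal_le_total [WellQuasiOrderedLE P]
    (h22 : ∀ a b c d : P, a < b → c < d → a < d ∨ c < b)
    (hF : LocConst F) (hG : LocConst G) (hF' : ¬ EvConst U F) (hG' : ¬ EvConst U G) :
    limitIdeal U F ≤ limitIdeal U G ∨ limitIdeal U G ≤ limitIdeal U F := by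
  by_contra! h
  obtain ⟨a, haF, haG⟩ := Set.not_subset.1 h.1
  obtain ⟨c, hcG, hcF⟩ := Set.not_subset.1 h.2
  obtain ⟨b, hb, hab⟩ := hF.exists_lt_mem_limitIdeal hF' haF
  obtain ⟨d, hd, hcd⟩ := hG.exists_lt_mem_limitIdeal hG' hcG
  rcases h22 a b c d hab hcd with h | h
  · exact haG ((limitIdeal U G).lower h.le hd)
  · exact hcF ((limitIdeal U F).lower h.le hb)

theorem wellFounded_lt_lowerSet [WellQuasiOrderedLE P] :
    WellFounded ((· < ·) : LowerSet P → LowerSet P → Prop) := by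
  refine wellFounded_iff_isEmpty_descending_chain.2 ⟨fun ⟨I, hI⟩ => ?_⟩
  choose y hy hy' using fun n => Set.exists_of_ssubset (hI n)
  have hanti : Antitone I := antitone_nat_of_succ_le fun n => (hI n).le
  obtain ⟨m, n, hmn, hle⟩ := wellQuasiOrdered_le y
  exact hy' m ((I (m + 1)).lower hle (hanti hmn (hy n)))

/-- A locally constant map into a well-quasi-ordered poset without `2 + 2` is eventually good. -/
theorem LocConst.ev_le_tail [WellQuasiOrderedLE P]
    (h22 : ∀ a b c d : P, a < b → c < d → a < d ∨ c < b) (hF : LocConst F) :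
    Ev U fun x => F x ≤ F x.tail := by
  wlog hcl : Clean U F generalizing F
  · obtain ⟨G, hG, hGc, hFG⟩ := hF.exists_clean (U := U)
    refine ((this hG hGc).and (hFG.and hFG.tail)).mono fun x hx => ?_
    rw [hx.2.1, hx.2.2]
    exact hx.1
  by_cases hc : EvConst U F
  · obtain ⟨c, hc⟩ := hcl [] hc
    exact .of_forall _ fun x => ((hc x).trans (hc x.tail).symm).le
  obtain ⟨k, hk, hk1, hk2⟩ := hF.exists_modulus
  have hpos : ∀ x, 0 < k x := fun x => by
    by_contra h0
    have h0 : k x = 0 := by omega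
    exact hc ⟨F x, .of_forall _ fun z => by simpa [h0] using hk1 x z⟩
  let pre : Stream' ℕ → List ℕ := fun x => x.take (k x - 1)
  have hpre : LocConst pre := LocConst.take (hk.comp (· - 1))
  let I : Stream' ℕ → LowerSet P := fun x => limitIdeal U fun z => F (pre x ++ₛ z)
  have hI : LocConst I := hpre.comp fun s => limitIdeal U fun z => F (s ++ₛ z)
  -- Were this section eventually constant, cleanness would make it constant, against the minimality
  -- of `k x`.
  have hnc : ∀ x, ¬ EvConst U fun z => F (pre x ++ₛ z) := fun x h => by
    obtain ⟨c, hc⟩ := hcl _ h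
    obtain ⟨z, hz⟩ := hk2 x (k x - 1) (Nat.sub_lt (hpos x) one_pos)
    have := hc (x.drop (k x - 1))
    rw [append_take_drop] at this
    exact hz ((hc z).trans this.symm)
  by_contra hbad
  rw [Ev.not_iff (hF.comp₂ hF.tail (· ≤ ·))] at hbad
  let Q : List ℕ → Stream' ℕ → Prop := fun s x =>
    (¬ F x ≤ F x.tail ∧ F (s ++ₛ x) ∈ limitIdeal U fun z => F (s ++ₛ z)) ∧
      (¬ k x.tail < k x ∧ ¬ I x.tail < I x)
  have hQl : ∀ s, LocConst (Q s) := fun s =>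
    ((hF.comp₂ hF.tail fun a b => ¬ a ≤ b).comp₂
      ((hF.append s).comp (· ∈ limitIdeal U fun z => F (s ++ₛ z))) And).comp₂
    ((hk.tail.comp₂ hk fun a b => ¬ a < b).comp₂ (hI.tail.comp₂ hI fun a b => ¬ a < b) And) And
  have hQ : ∀ s, Ev U (Q s) := fun s =>
    (hbad.and (hF.append s).ev_mem_limitIdeal).and
      ((Ev.not_rel_tail wellFounded_lt hk).and (Ev.not_rel_tail wellFounded_lt_lowerSet hI))
  obtain ⟨X, hX⟩ := Ev.exists_generic hQ
  have hXQ : ∀ n, Q (X.take n) (X.drop n) := fun n => Ev.mem_of_generic (hQl _) (hX n)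
  have hkX : k X ≤ k X.tail := not_lt.1 (hXQ 0).2.1
  have hIX : I X ≤ I X.tail := by
    rcases limitIdeal_le_total h22 (hF.append (pre X)) (hF.append (pre X.tail)) (hnc _) (hnc _)
      with h | h
    · exact h
    · exact (h.eq_of_not_lt (hXQ 0).2.2).ge
  have hmem : F X ∈ I X := by
    have := (hXQ (k X - 1)).1.2
    rwa [append_take_drop] at this
  -- The sequence `X.take (k X.tail) ++ₛ z` keeps the value `F X`, while its tail is `pre X.tail ++ₛ
  -- z`: dropping the head leaves `k X.tail - 1` terms. So it is good, though generically bad.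
  obtain ⟨z, hz, hz'⟩ := ((hIX hmem : Ev U _).and (hX 0 (k X.tail))).exists_mem
  refine hz'.1.1 ?_
  obtain ⟨n, hn⟩ : ∃ n, k X.tail = n + 1 := ⟨k X.tail - 1, by have := hpos X.tail; omega⟩
  simp only [pre, hn, Nat.add_sub_cancel] at hz
  obtain ⟨w, hw⟩ := LocConst.take_append_of_le (x := X) (z := z) hkX
  simp only [drop_zero]
  rw [hw, hk1, ← hw, hn, take_succ, cons_append_stream, tail_cons]
  exact hz

end Limit

/-! ### Maps on barriers as locally constant functions -/

section Barrier

variable {B : Set (Finset ℕ)}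

/-- The set of the first `n` terms of a sequence. -/
def initSet (x : Stream' ℕ) (n : ℕ) : Finset ℕ := (Finset.range n).image x.get

theorem mem_initSet {x : Stream' ℕ} {n a : ℕ} : a ∈ initSet x n ↔ ∃ i < n, x.get i = a := by
  simp [initSet]

theorem initSet_mono (x : Stream' ℕ) {m n : ℕ} (h : m ≤ n) : initSet x m ⊆ initSet x n :=
  Finset.image_subset_image (Finset.range_subset_range.2 h)

/-- `s` belongs to `B` and consists of the first terms of `x`, which are strictly increasing. -/
def IsBarPrefix (B : Set (Finset ℕ)) (x : Stream' ℕ) (s : Finset ℕ) : Prop :=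
  s ∈ B ∧ ∃ n, s = initSet x n ∧ ∀ i, i + 1 < n → x.get i < x.get (i + 1)

theorem IsBarPrefix.unique (hB : IsAntichain (· ⊆ ·) B) {x : Stream' ℕ} {s t : Finset ℕ}
    (hs : IsBarPrefix B x s) (ht : IsBarPrefix B x t) : s = t := by
  obtain ⟨hs, n, rfl, -⟩ := hs
  obtain ⟨ht, m, rfl, -⟩ := ht
  rcases le_total n m with h | h
  · exact hB.eq hs ht (initSet_mono x h)
  · exact (hB.eq ht hs (initSet_mono x h)).symm

theorem IsBarPrefix.congr {x z : Stream' ℕ} {n : ℕ} (h : ∀ i < n, z.get i = x.get i)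
    (hs : initSet x n ∈ B) (hx : ∀ i, i + 1 < n → x.get i < x.get (i + 1)) :
    IsBarPrefix B z (initSet x n) := by
  refine ⟨hs, n, Finset.image_congr fun i hi => (h i (by simpa using hi)).symm, fun i hi => ?_⟩
  rw [h i (by omega), h _ hi]
  exact hx i hi

/-- The sequence is strictly increasing with terms in the base of `B`. -/
def IsAdmissible (B : Set (Finset ℕ)) (x : Stream' ℕ) : Prop :=
  ∀ i, x.get i ∈ base B ∧ x.get i < x.get (i + 1)

theorem IsAdmissible.strictMono {x : Stream' ℕ} (hx : IsAdmissible B x) : StrictMono x.get :=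
  strictMono_nat_of_lt_succ fun i => (hx i).2

theorem IsAdmissible.exists_isBarPrefix (hB : IsBlock B) {x : Stream' ℕ}
    (hx : IsAdmissible B x) : ∃ s, IsBarPrefix B x s := by
  obtain ⟨s, hs, -, hsub, hinit⟩ := hB.2 (Set.range x.get)
    (Set.infinite_range_of_injective hx.strictMono.injective)
    (Set.range_subset_iff.2 fun i => (hx i).1)
  have hex : ∃ n, x.get n ∉ s := by
    by_contra! h
    exact (Set.infinite_range_of_injective hx.strictMono.injective)
      (s.finite_toSet.subset (Set.range_subset_iff.2 h))
  classical
  refine ⟨s, hs, Nat.find hex, ?_, fun i _ => (hx i).2⟩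
  ext a
  rw [mem_initSet]
  constructor
  · intro ha
    obtain ⟨i, rfl⟩ := hsub ha
    refine ⟨i, ?_, rfl⟩
    by_contra! hi
    exact Nat.find_spec hex (hinit _ ⟨_, rfl⟩ _ ha (hx.strictMono.monotone hi))
  · rintro ⟨i, hi, rfl⟩
    simpa using Nat.find_min hex hi

/-- A bar prefix is seen on finitely many terms; its absence is too, since it forces a failure of
admissibility at some `j`, which rules out every bar prefix longer than `j + 1`. -/
theorem locConst_isBarPrefix (hB : IsBarrier B) : LocConst (IsBarPrefix B) := by
  have key : ∀ x : Stream' ℕ, ∃ n, ∀ z : Stream' ℕ, (∀ i < n, z.get i = x.get i) →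
      IsBarPrefix B z = IsBarPrefix B x := by
    intro x
    by_cases h : ∃ s, IsBarPrefix B x s
    · obtain ⟨s, hs⟩ := h
      obtain ⟨hsB, n, rfl, hx⟩ := id hs
      refine ⟨n, fun z hz => ?_⟩
      have hz := IsBarPrefix.congr hz hsB hx
      ext t
      exact ⟨fun ht => (hz.unique hB.2 ht) ▸ hs, fun ht => (hs.unique hB.2 ht) ▸ hz⟩
    · have hna : ¬ IsAdmissible B x := fun hx => h (hx.exists_isBarPrefix hB.1)
      obtain ⟨j, hj⟩ := not_forall.1 hna
      refine ⟨j + 2, fun z hz => ?_⟩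
      ext t
      refine ⟨?_, fun ht => absurd ⟨t, ht⟩ h⟩
      rintro ⟨ht, m, rfl, hm⟩
      exfalso
      rcases lt_or_ge m (j + 2) with hmj | hmj
      · exact h ⟨_, IsBarPrefix.congr (fun i hi => (hz i (by omega)).symm) ht hm⟩
      · apply hj
        rw [← hz j (by omega), ← hz (j + 1) (by omega)]
        exact ⟨⟨_, ht, mem_initSet.2 ⟨j, by omega, rfl⟩⟩, hm j (by omega)⟩
  intro x
  obtain ⟨n, hn⟩ := key x
  refine ⟨n, fun z => hn _ fun i hi => ?_⟩
  rw [Stream'.get_append_left _ _ _ (by simpa using hi)]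
  simp

/-- The bar prefixes of a sequence and of its tail are related by `Tri`. -/
theorem IsBarPrefix.tri (hB : IsAntichain (· ⊆ ·) B) {x : Stream' ℕ} (hx : IsAdmissible B x)
    {s t : Finset ℕ} (hs : IsBarPrefix B x s) (ht : IsBarPrefix B x.tail t) : Tri s t := by
  obtain ⟨hs, n, rfl, -⟩ := hs
  obtain ⟨ht, m, rfl, -⟩ := ht
  -- Otherwise `t ⊆ s`, hence `t = s` by the antichain property, but `t` misses `x.get 0`.
  have hnm : n ≤ m := by
    by_contra! h
    have hsub : initSet x.tail m ⊆ initSet x n := by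
      intro a ha
      obtain ⟨i, hi, rfl⟩ := mem_initSet.1 ha
      exact mem_initSet.2 ⟨i + 1, by omega, rfl⟩
    have h0 : x.get 0 ∈ initSet x.tail m := by
      rw [hB.eq ht hs hsub]
      exact mem_initSet.2 ⟨0, by omega, rfl⟩
    obtain ⟨i, -, hi⟩ := mem_initSet.1 h0
    exact absurd (hx.strictMono.injective hi) (by omega)
  refine ⟨initSet x (m + 1), ⟨?_, ?_⟩, ?_, ?_⟩
  · exact_mod_cast initSet_mono x (by omega)
  · intro a ha b hb hab
    obtain ⟨i, -, rfl⟩ := mem_initSet.1 (Finset.mem_coe.1 ha)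
    obtain ⟨j, hj, rfl⟩ := mem_initSet.1 hb
    exact mem_initSet.2 ⟨i, (hx.strictMono.le_iff_le.1 hab).trans_lt hj, rfl⟩
  · intro h
    have : x.get m ∈ initSet x n := h ▸ mem_initSet.2 ⟨m, by omega, rfl⟩
    obtain ⟨i, hi, him⟩ := mem_initSet.1 this
    exact absurd (hx.strictMono.injective him) (by omega)
  · ext a
    simp only [Bqo.tail, Finset.mem_filter, mem_initSet]
    constructor
    · rintro ⟨i, hi, rfl⟩
      exact ⟨⟨i + 1, by omega, rfl⟩, x.get 0, ⟨0, by omega, rfl⟩, hx.strictMono (Nat.succ_pos i)⟩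
    · rintro ⟨⟨i, hi, rfl⟩, _, ⟨j, -, rfl⟩, hji⟩
      have := hx.strictMono.lt_iff_lt.1 hji
      exact ⟨i - 1, by omega, by rw [get_tail]; congr 1; omega⟩

theorem base_infinite (hB : B.Infinite) : (base B).Infinite := by
  intro h
  refine hB ((h.toFinset.powerset.finite_toSet).subset fun s hs => ?_)
  simp only [Finset.coe_powerset, Set.mem_preimage, Set.mem_powerset_iff, Set.Finite.coe_toFinset]
  exact fun a ha => ⟨s, hs, ha⟩

/-- Every map from a barrier to a well-quasi-ordered poset without `2 + 2` is good. -/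
theorem IsBarrier.isGood {P : Type*} [PartialOrder P] [WellQuasiOrderedLE P]
    (h22 : ∀ a b c d : P, a < b → c < d → a < d ∨ c < b) (hB : IsBarrier B) (f : B → P) :
    IsGood f := by
  classical
  have hinf := base_infinite hB.1.1
  have : (cofinite ⊓ 𝓟 (base B)).NeBot := hinf.cofinite_inf_principal_neBot
  let U : Ultrafilter ℕ := Ultrafilter.of (cofinite ⊓ 𝓟 (base B))
  have hU : (U : Filter ℕ) ≤ cofinite ⊓ 𝓟 (base B) := Ultrafilter.of_le _
  have hbase : ∀ᶠ p in U, p ∈ base B := (hU.trans inf_le_right) (mem_principal_self _)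
  have hgt : ∀ a : ℕ, ∀ᶠ p in U, a < p := fun a =>
    (hU.trans inf_le_left) ((Set.finite_Iic a).subset fun p hp => by simpa using hp)
  obtain ⟨s₀, hs₀⟩ := hB.1.1.nonempty
  -- The default value is harmless: `U` is nonprincipal and contains the base, so the sequence `X`
  -- chosen below is admissible and has a bar prefix.
  let φ : (Finset ℕ → Prop) → P := fun S => if h : ∃ s, s ∈ B ∧ S s then f ⟨_, h.choose_spec.1⟩
    else f ⟨s₀, hs₀⟩
  let F : Stream' ℕ → P := fun x => φ (IsBarPrefix B x)
  have hF : LocConst F := (locConst_isBarPrefix hB).comp φ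
  have hFs : ∀ x, (∃ s, IsBarPrefix B x s) → ∃ s : B, IsBarPrefix B x s ∧ F x = f s := by
    rintro x ⟨s, hs⟩
    have h : ∃ s, s ∈ B ∧ IsBarPrefix B x s := ⟨s, hs.1, hs⟩
    exact ⟨⟨_, h.choose_spec.1⟩, h.choose_spec.2, dif_pos h⟩
  have hadm : Ev U fun x => x.get 0 ∈ base B ∧ x.get 0 < x.get 1 := by
    refine .of_eventually (hbase.mono fun p hp => .of_eventually ((hgt p).mono fun q hq => ?_))
    exact .of_forall _ fun x => ⟨hp, hq⟩
  have hle := hF.ev_le_tail (U := U) h22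
  have hl : LocConst fun x : Stream' ℕ => (x.get 0 ∈ base B ∧ x.get 0 < x.get 1) ∧ F x ≤ F x.tail :=
    ((LocConst.get 0).comp₂ (LocConst.get 1) fun a b => a ∈ base B ∧ a < b).comp₂
      (hF.comp₂ hF.tail (· ≤ ·)) And
  obtain ⟨X, hX⟩ := Ev.exists_generic fun _ => hadm.and hle
  have hXQ := fun n => Ev.mem_of_generic hl (hX n)
  have hXa : IsAdmissible B X := fun i => by
    have := (hXQ i).1
    simpa [get_drop] using this
  have hXa' : IsAdmissible B X.tail := fun i => hXa (i + 1)
  obtain ⟨s, hs, hFX⟩ := hFs X (hXa.exists_isBarPrefix hB.1)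
  obtain ⟨t, ht, hFt⟩ := hFs X.tail (hXa'.exists_isBarPrefix hB.1)
  refine ⟨s, t, hs.tri hB.2 hXa ht, ?_⟩
  rw [← hFX, ← hFt]
  exact (hXQ 0).2

end Barrier

/-! ### The barrier of singletons -/

theorem lexLT_singleton {m n : ℕ} : LexLT {m} {n} ↔ m < n := by
  simp [LexLT]

theorem Tri.singleton {m n : ℕ} (h : Tri {m} {n}) : m < n := by
  obtain ⟨r, hr, -, ht⟩ := h
  have hn : n ∈ tail r := ht ▸ Finset.mem_singleton_self n
  obtain ⟨hnr, y, hy, hyn⟩ := Finset.mem_filter.1 hn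
  by_contra! h
  have h1 := Finset.mem_singleton.1 (hr.2 n hnr m (Finset.mem_singleton_self m) h)
  have h2 := Finset.mem_singleton.1
    (hr.2 y hy m (Finset.mem_singleton_self m) (hyn.le.trans h))
  omega

theorem isBarrier_singletons : IsBarrier (Set.range fun n : ℕ => ({n} : Finset ℕ)) := by
  refine ⟨⟨Set.infinite_range_of_injective Finset.singleton_injective, fun X hX _ => ?_⟩, ?_⟩
  · obtain ⟨a, ha, hmin⟩ := WellFounded.has_min wellFounded_lt X hX.nonempty
    refine ⟨{a}, ⟨a, rfl⟩, Finset.singleton_ne_empty a, by simpa using ha, fun x hx y hy hxy => ?_⟩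
    rw [Finset.mem_singleton] at hy ⊢
    exact le_antisymm (hy ▸ hxy) (not_lt.1 (hmin x hx))
  · rintro _ ⟨m, rfl⟩ _ ⟨n, rfl⟩ hne hsub
    exact hne (congrArg _ (Finset.singleton_subset_singleton.1 hsub))

theorem IsBqo.wellQuasiOrderedLE {P : Type*} [PartialOrder P] (h : IsBqo P) :
    WellQuasiOrderedLE P := by
  refine ⟨fun g => ?_⟩
  let B : Set (Finset ℕ) := Set.range fun n : ℕ => ({n} : Finset ℕ)
  let e : ((· < ·) : ℕ → ℕ → Prop) ≃r (fun s t : B => LexLT s t) :=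
    { toEquiv := Equiv.ofInjective _ Finset.singleton_injective
      map_rel_iff' := lexLT_singleton }
  have hwo : IsWellOrder B fun s t => LexLT s t := e.symm.toRelEmbedding.isWellOrder
  have hcard : (Ordinal.type fun s t : B => LexLT s t).card ≤ Cardinal.aleph0 := by
    rw [Ordinal.card_type]
    exact Cardinal.mk_le_aleph0_iff.2 (Set.countable_range _).to_subtype
  obtain ⟨⟨_, m, rfl⟩, ⟨_, n, rfl⟩, htri, hle⟩ :=
    -- The sum reads `n` off the singleton `{n}`.
    h _ hcard B isBarrier_singletons ⟨hwo, le_rfl⟩ fun s => g (∑ i ∈ s.1, i)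
  exact ⟨m, n, htri.singleton, by simpa using hle⟩

/-! ### Interval orders -/

/-- If both alternatives failed, witnesses would close a cycle `x < v ≤ u < y ≤ x` in the chain. -/
theorem IsIntervalOrder.lt_or_lt {P : Type u} [PartialOrder P] (hP : IsIntervalOrder.{u, v} P)
    (a b c d : P) (hab : a < b) (hcd : c < d) : a < d ∨ c < b := by
  obtain ⟨C, _, S, ⟨e⟩⟩ := hP
  have lt_iff : ∀ p q : P, p < q ↔ ∀ x ∈ (e p).1.1, ∀ y ∈ (e q).1.1, x < y := fun p q =>
    e.lt_iff_lt.symm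
  rw [lt_iff] at hab hcd ⊢
  rw [lt_iff]
  by_contra! h
  obtain ⟨⟨x, hx, y, hy, hyx⟩, u, hu, v, hv, hvu⟩ := h
  exact absurd (((hab x hx v hv).trans_le hvu).trans (hcd u hu y hy)) hyx.not_gt

end Bqo

/-- An interval order is better-quasi-ordered if and only if it is well-quasi-ordered. -/
theorem theorem1p6 (P : Type u) [PartialOrder P] (hP : Bqo.IsIntervalOrder.{u, v} P) :
    Bqo.IsBqo P ↔ WellQuasiOrderedLE P :=
  ⟨fun h => h.wellQuasiOrderedLE, fun _ _ _ _ hB _ f => hB.isGood hP.lt_or_lt f⟩
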